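/- For $M=\begin{bmatrix}a&b\\c&d\end{bmatrix}\in\mathrm{SL}(2,\mathbb{Z})$ let $f_M$ be the fractional linear map $f_M(x)=\frac{ax+b}{cx+d}$ on $\mathbb{Q}\cup\{\infty\}$, where $f_M(x)=\infty$ if $x\in\mathbb{Q}$ and $cx+d=0$, $f_M(\infty)=\frac{a}{c}$ if $c\neq 0$, and $f_M(\infty)=\infty$ if $c=0$. For a finite collection $M_1,\ldots,M_n$ of matrices from $\mathrm{SL}(2,\mathbb{Z})$ let $\langle M_1,\ldots,M_n\rangle$ be the multiplicative semigroup, including the identity matrix, generated by $M_1,\ldots,M_n$. Then the following two problems are algorithmically decidable. (1) The vector reachability problem in $\mathrm{SL}(2,\mathbb{Z})$: given two vectors $\mathbf{x},\mathbf{y}\in\mathbb{Z}^2$ and a finite collection of matrices $M_1,\ldots,M_n$ from $\mathrm{SL}(2,\mathbb{Z})$, decide whether there exists a matrix $M\in\langle M_1,\ldots,M_n\rangle$ such that $M\mathbf{x}=\mathbf{y}$. (2) The reachability problem by fractional linear transformations in $\mathrm{SL}(2,\mathbb{Z})$: given two rational numbers $x$ and $y$ and a finite collection of matrices $M_1,\ldots,M_n$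 from $\mathrm{SL}(2,\mathbb{Z})$, decide whether there exists a matrix $M\in\langle M_1,\ldots,M_n\rangle$ such that $f_M(x)=y$. -/

import Mathlib

open scoped MatrixGroups

/-- A decision problem with set of instances `I` and yes-instances `P`, where an instance `i` is
written down as the code `code i`, is decidable if the set of the codes of its yes-instances is
a recursive (computable) set. -/
def IsDecidableProblem {I C : Type} [Primcodable C] (code : I → C) (P : I → Prop) : Prop :=
  Function.Injective code ∧ ComputablePred fun c : C => ∃ i : I, code i = c ∧ P i

/-- A vector with two integer coefficients is given by its two coefficients. -/
def vectorCode (x : Fin 2 → ℤ) : ℤ × ℤ := (x 0, x 1)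

/-- A matrix in `SL(2,ℤ)` is given by its four entries, row by row. -/
def matrixCode (M : SL(2, ℤ)) : (ℤ × ℤ) × (ℤ × ℤ) := ((M 0 0, M 0 1), (M 1 0, M 1 1))

/-- A rational number is given by its numerator and its denominator in lowest terms. -/
def ratCode (q : ℚ) : ℤ × ℕ := (q.num, q.den)

/-- `⟨M₁, …, Mₙ⟩`: the multiplicative semigroup, including the identity matrix, generated by a
finite collection of matrices. -/
def generatedSemigroup (Ms : List SL(2, ℤ)) : Submonoid SL(2, ℤ) :=
  Submonoid.closure {M | M ∈ Ms}

/-- The fractional linear map `f_M(x) = (a x + b) / (c x + d)` on `ℚ ∪ {∞}`, with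
`f_M(x) = ∞` if `c x + d = 0`, `f_M(∞) = a / c` if `c ≠ 0` and `f_M(∞) = ∞` if `c = 0`. -/
def fracLinearMap (M : SL(2, ℤ)) : OnePoint ℚ → OnePoint ℚ
  | some x =>
      if (M 1 0 : ℚ) * x + (M 1 1 : ℚ) = 0 then OnePoint.infty
      else ((((M 0 0 : ℚ) * x + (M 0 1 : ℚ)) / ((M 1 0 : ℚ) * x + (M 1 1 : ℚ)) : ℚ) : OnePoint ℚ)
  | none =>
      if (M 1 0 : ℚ) = 0 then OnePoint.infty
      else (((M 0 0 : ℚ) / (M 1 0 : ℚ) : ℚ) : OnePoint ℚ)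

/-- An instance of the vector reachability problem in `SL(2,ℤ)`: two integer vectors and a finite
collection of matrices. -/
structure VectorInstance where
  source : Fin 2 → ℤ
  target : Fin 2 → ℤ
  generators : List SL(2, ℤ)

/-- The data by which an instance of the vector reachability problem is given. -/
def VectorInstance.code (i : VectorInstance) :
    ((ℤ × ℤ) × (ℤ × ℤ)) × List ((ℤ × ℤ) × (ℤ × ℤ)) :=
  ((vectorCode i.source, vectorCode i.target), i.generators.map matrixCode)

/-- Some matrix of the generated semigroup maps the source vector to the target vector. -/
def VectorInstance.Reachable (i : VectorInstance) : Prop :=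
  ∃ M ∈ generatedSemigroup i.generators,
    (M : Matrix (Fin 2) (Fin 2) ℤ).mulVec i.source = i.target

/-- An instance of the reachability problem by fractional linear transformations in `SL(2,ℤ)`:
two rational numbers and a finite collection of matrices. -/
structure PointInstance where
  source : ℚ
  target : ℚ
  generators : List SL(2, ℤ)

/-- The data by which an instance of the reachability problem by fractional linear
transformations is given. -/
def PointInstance.code (i : PointInstance) :
    ((ℤ × ℕ) × (ℤ × ℕ)) × List ((ℤ × ℤ) × (ℤ × ℤ)) :=
  ((ratCode i.source, ratCode i.target), i.generators.map matrixCode)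

/-- The fractional linear map of some matrix of the generated semigroup maps the source point to
the target point. -/
def PointInstance.Reachable (i : PointInstance) : Prop :=
  ∃ M ∈ generatedSemigroup i.generators,
    fracLinearMap M (i.source : OnePoint ℚ) = (i.target : OnePoint ℚ)

/-! ### Computability of integer and matrix arithmetic -/

/-! Both the yes-instances and their complement are recursively enumerable, so Post's theorem gives
decidability (`ComputablePred.of_certificates`). Reachability is certified by a word in the
generators; the work lies in certifying unreachability.

Write the source as `A (d, 0)` and move the target to `(d', 0)` by `B`, with `A`, `B` of determinant
one and `d`, `d'` natural numbers. If `d ≠ d'` the target is unreachable; if `d = d' = 0` the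
identity suffices. Otherwise the stabilizer of `(d, 0)` consists of the matrices `upper k`, so
unreachability says that no product `M * A * upper k * B` is the identity (`not_reachable_iff`).

These products are the labels of the paths of a finite automaton whose letters lie in the two finite
subgroups, of orders four and six, that generate `SL(2,ℤ)`. By ping-pong (`growth_of_reduced`) a
reduced word of length at least two is never the identity. Hence, once the edge set is closed under
composing compatible letters, an accepted identity collapses to one edge labelled `1`
(`IsPath.edge_of_prod_eq_one`). A saturated automaton without that edge is therefore a sound
certificate (`Separates.ne_one`), and one exists whenever the answer is negative
(`exists_separates`). It need not be constructed effectively: a search finds it, because its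
defining conditions are primitive recursive.

For fractional linear maps, lowest terms are unique up to sign, so the point problem is a
disjunction of two vector problems (`fracLinearMap_coe_eq_coe_iff`). -/

theorem REPred.exists_of_primrecRel {α β : Type*} [Primcodable α] [Primcodable β]
    {R : α → β → Prop} (hR : PrimrecRel R) : REPred fun a => ∃ b, R a b := by
  classical
  have hf : Primrec₂ fun (a : α) (n : ℕ) =>
      ((Encodable.decode n : Option β).map fun b => decide (R a b)).getD false :=
    Primrec.option_getD.comp
      (Primrec.option_map (Primrec.decode.comp Primrec.snd)
        (hR.decide.comp (Primrec.fst.comp Primrec.fst) Primrec.snd))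
      (Primrec.const false)
  refine (Partrec.rfind hf.to_comp.partrec₂).dom_re.of_eq fun a => ?_
  simp only [Nat.rfind_dom, PFun.coe_val, Part.mem_some_iff, Part.some_dom, implies_true, and_true]
  constructor
  · rintro ⟨n, hn⟩
    rcases hd : (Encodable.decode n : Option β) with _ | b
    · simp [hd] at hn
    · exact ⟨b, by simpa [hd] using hn⟩
  · rintro ⟨b, hb⟩
    exact ⟨Encodable.encode b, by simp [hb]⟩

theorem ComputablePred.of_certificates {α β γ : Type*} [Primcodable α] [Primcodable β]
    [Primcodable γ] {p : α → Prop} {R : α → β → Prop} {S : α → γ → Prop}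
    (hR : PrimrecRel R) (hS : PrimrecRel S) (hp : ∀ a, p a ↔ ∃ b, R a b)
    (hn : ∀ a, ¬ p a ↔ ∃ c, S a c) : ComputablePred p :=
  ComputablePred.computable_iff_re_compl_re'.2
    ⟨(REPred.exists_of_primrecRel hR).of_eq fun a => (hp a).symm,
      (REPred.exists_of_primrecRel hS).of_eq fun a => (hn a).symm⟩

theorem ComputablePred.and_pred {α : Type*} [Primcodable α] {p q : α → Prop}
    (hp : ComputablePred p) (hq : ComputablePred q) : ComputablePred fun a => p a ∧ q a := by
  obtain ⟨_, hp⟩ := hp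
  obtain ⟨_, hq⟩ := hq
  exact Computable.computablePred ((Primrec.and.to_comp.comp hp hq).of_eq fun a => by simp)

theorem ComputablePred.or_pred {α : Type*} [Primcodable α] {p q : α → Prop}
    (hp : ComputablePred p) (hq : ComputablePred q) : ComputablePred fun a => p a ∨ q a := by
  obtain ⟨_, hp⟩ := hp
  obtain ⟨_, hq⟩ := hq
  exact Computable.computablePred ((Primrec.or.to_comp.comp hp hq).of_eq fun a => by simp)

theorem ComputablePred.comp_computable {α β : Type*} [Primcodable α] [Primcodable β] {p : β → Prop}
    {f : α → β} (hp : ComputablePred p) (hf : Computable f) : ComputablePred fun a => p (f a) := by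
  obtain ⟨_, hp⟩ := hp
  exact Computable.computablePred (hp.comp hf)

/-! ### Primitive recursive integer arithmetic -/

theorem encode_int_eq (z : ℤ) :
    Encodable.encode z = if 0 ≤ z then 2 * z.toNat else 2 * (-z).toNat - 1 := by
  rcases z with n | n
  · change 2 * n = _
    simp
  · change 2 * n + 1 = _
    rw [if_neg (by omega)]
    omega

/-- The parity of the code of an integer tells its sign, and half the code is the argument of the
constructor. -/
theorem primrec_of_nat_of_int {σ : Type*} [Primcodable σ] {f : ℤ → σ}
    (hp : Primrec fun n : ℕ => f n) (hn : Primrec fun n : ℕ => f (Int.negSucc n)) : Primrec f := by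
  refine Primrec.ofNat_iff.2 ((Primrec.ite (Primrec.eq.comp (Primrec.nat_mod.comp Primrec.id
    (Primrec.const 2)) (Primrec.const 0)) (hp.comp (Primrec.nat_div.comp Primrec.id
    (Primrec.const 2))) (hn.comp (Primrec.nat_div.comp Primrec.id (Primrec.const 2)))).of_eq ?_)
  intro n
  obtain ⟨z, rfl⟩ : ∃ z : ℤ, n = Encodable.encode z :=
    ⟨Denumerable.ofNat ℤ n, (Denumerable.encode_ofNat n).symm⟩
  rw [Denumerable.ofNat_encode]
  rcases z with k | k
  · rw [show Encodable.encode (Int.ofNat k) = 2 * k from rfl]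
    simp
  · rw [show Encodable.encode (Int.negSucc k) = 2 * k + 1 from rfl, id, if_neg (by omega)]
    congr 2
    omega

theorem primrec_int_toNat : Primrec Int.toNat :=
  primrec_of_nat_of_int (Primrec.id.of_eq fun n => by simp)
    ((Primrec.const 0).of_eq fun n => by simp)

theorem primrec_int_neg_toNat : Primrec fun z : ℤ => (-z).toNat :=
  primrec_of_nat_of_int ((Primrec.const 0).of_eq fun n => by simp)
    (Primrec.succ.of_eq fun n => by simp)

/-- The other ring operations reduce to this one by splitting integers into positive and negative
parts. -/
theorem primrec_natCast_sub : Primrec₂ fun m n : ℕ => (m : ℤ) - n := by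
  refine Primrec₂.encode_iff.1 ?_
  refine (Primrec.ite (Primrec.nat_le.comp Primrec.snd Primrec.fst)
    (Primrec.nat_mul.comp (Primrec.const 2) (Primrec.nat_sub.comp Primrec.fst Primrec.snd))
    (Primrec.nat_sub.comp (Primrec.nat_mul.comp (Primrec.const 2)
      (Primrec.nat_sub.comp Primrec.snd Primrec.fst)) (Primrec.const 1))).of_eq ?_
  rintro ⟨m, n⟩
  dsimp only
  rw [encode_int_eq]
  split_ifs <;> omega

theorem primrec_natCast_int : Primrec fun n : ℕ => (n : ℤ) :=
  (primrec_natCast_sub.comp Primrec.id (Primrec.const 0)).of_eq fun n => by simp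

theorem primrec_int_add : Primrec₂ ((· + ·) : ℤ → ℤ → ℤ) := by
  refine (primrec_natCast_sub.comp
    (Primrec.nat_add.comp (primrec_int_toNat.comp Primrec.fst) (primrec_int_toNat.comp Primrec.snd))
    (Primrec.nat_add.comp (primrec_int_neg_toNat.comp Primrec.fst)
      (primrec_int_neg_toNat.comp Primrec.snd))).of_eq ?_
  rintro ⟨x, y⟩
  dsimp only
  push_cast
  omega

theorem primrec_int_neg : Primrec fun z : ℤ => -z :=
  (primrec_natCast_sub.comp primrec_int_neg_toNat primrec_int_toNat).of_eq fun z => by omega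

theorem primrec_int_sub : Primrec₂ ((· - ·) : ℤ → ℤ → ℤ) :=
  (primrec_int_add.comp Primrec.fst (primrec_int_neg.comp Primrec.snd)).of_eq fun p =>
    (sub_eq_add_neg p.1 p.2).symm

theorem primrec_int_mul : Primrec₂ ((· * ·) : ℤ → ℤ → ℤ) := by
  have hp : Primrec fun p : ℤ × ℤ => p.1.toNat := primrec_int_toNat.comp Primrec.fst
  have hq : Primrec fun p : ℤ × ℤ => p.2.toNat := primrec_int_toNat.comp Primrec.snd
  have hp' : Primrec fun p : ℤ × ℤ => (-p.1).toNat := primrec_int_neg_toNat.comp Primrec.fst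
  have hq' : Primrec fun p : ℤ × ℤ => (-p.2).toNat := primrec_int_neg_toNat.comp Primrec.snd
  refine (primrec_natCast_sub.comp
    (Primrec.nat_add.comp (Primrec.nat_mul.comp hp hq) (Primrec.nat_mul.comp hp' hq'))
    (Primrec.nat_add.comp (Primrec.nat_mul.comp hp hq') (Primrec.nat_mul.comp hp' hq))).of_eq ?_
  rintro ⟨x, y⟩
  dsimp only
  have hx : x = x.toNat - (-x).toNat := by omega
  have hy : y = y.toNat - (-y).toNat := by omega
  conv_rhs => rw [hx, hy]
  push_cast
  ring

/-! ### Primitive recursive matrix arithmetic -/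

/-- Integer `2 × 2` matrices. -/
abbrev IntMat := Matrix (Fin 2) (Fin 2) ℤ

/-- A `2 × 2` matrix as its entries, row by row. -/
def entriesEquiv : IntMat ≃ (ℤ × ℤ) × (ℤ × ℤ) where
  toFun M := ((M 0 0, M 0 1), (M 1 0, M 1 1))
  invFun c := !![c.1.1, c.1.2; c.2.1, c.2.2]
  left_inv M := (Matrix.eta_fin_two M).symm
  right_inv _ := rfl

theorem entriesEquiv_apply (M : IntMat) :
    entriesEquiv M = ((M 0 0, M 0 1), (M 1 0, M 1 1)) := rfl

instance : Primcodable IntMat := Primcodable.ofEquiv _ entriesEquiv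

theorem primrec_entries : Primrec entriesEquiv := Primrec.of_equiv

theorem primrec_entriesEquiv_symm : Primrec entriesEquiv.symm := Primrec.of_equiv_symm

/-- The image of a vector, given by its coefficients, under a matrix. -/
def IntMat.apply (M : IntMat) (v : ℤ × ℤ) : ℤ × ℤ :=
  (M 0 0 * v.1 + M 0 1 * v.2, M 1 0 * v.1 + M 1 1 * v.2)

section
variable {α : Type*} [Primcodable α] {f g : α → ℤ} {F G : α → IntMat}

theorem Primrec.int_add (hf : Primrec f) (hg : Primrec g) : Primrec fun a => f a + g a :=
  primrec_int_add.comp hf hg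

theorem Primrec.int_sub (hf : Primrec f) (hg : Primrec g) : Primrec fun a => f a - g a :=
  primrec_int_sub.comp hf hg

theorem Primrec.int_mul (hf : Primrec f) (hg : Primrec g) : Primrec fun a => f a * g a :=
  primrec_int_mul.comp hf hg

theorem Primrec.entry (hF : Primrec F) (i j : Fin 2) : Primrec fun a => F a i j := by
  have h := primrec_entries.comp hF
  match i, j with
  | 0, 0 => exact Primrec.fst.comp (Primrec.fst.comp h)
  | 0, 1 => exact Primrec.snd.comp (Primrec.fst.comp h)
  | 1, 0 => exact Primrec.fst.comp (Primrec.snd.comp h)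
  | 1, 1 => exact Primrec.snd.comp (Primrec.snd.comp h)

theorem Primrec.matrix_mul (hF : Primrec F) (hG : Primrec G) : Primrec fun a => F a * G a := by
  have h (i j : Fin 2) : Primrec fun a => F a i 0 * G a 0 j + F a i 1 * G a 1 j :=
    ((hF.entry i 0).int_mul (hG.entry 0 j)).int_add ((hF.entry i 1).int_mul (hG.entry 1 j))
  refine (primrec_entriesEquiv_symm.comp
    (((h 0 0).pair (h 0 1)).pair ((h 1 0).pair (h 1 1)))).of_eq fun a => ?_
  apply entriesEquiv.injective
  rw [Equiv.apply_symm_apply]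
  simp only [entriesEquiv_apply, Matrix.mul_apply, Fin.sum_univ_two]

theorem Primrec.matrix_det (hF : Primrec F) : Primrec fun a => (F a).det :=
  (((hF.entry 0 0).int_mul (hF.entry 1 1)).int_sub
    ((hF.entry 0 1).int_mul (hF.entry 1 0))).of_eq fun a => (Matrix.det_fin_two (F a)).symm

theorem Primrec.matrix_apply (hF : Primrec F) {v : α → ℤ × ℤ} (hv : Primrec v) :
    Primrec fun a => (F a).apply (v a) :=
  (((hF.entry 0 0).int_mul (fst.comp hv)).int_add ((hF.entry 0 1).int_mul (snd.comp hv))).pair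
    (((hF.entry 1 0).int_mul (fst.comp hv)).int_add ((hF.entry 1 1).int_mul (snd.comp hv)))

theorem Primrec.matrix_list_prod {w : α → List IntMat} (hw : Primrec w) :
    Primrec fun a => (w a).prod :=
  (Primrec.list_foldr hw (Primrec.const 1)
    ((Primrec.fst.comp Primrec.snd).matrix_mul (Primrec.snd.comp Primrec.snd)).to₂).of_eq fun a => by
      rw [List.prod_eq_foldr]
end

theorem primrecRel_mem {α : Type*} [Primcodable α] :
    PrimrecRel fun (a : α) (l : List α) => a ∈ l :=
  (PrimrecRel.exists_mem_list Primrec.eq).swap.of_eq fun a l => by simp [Function.swap]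

theorem primrecPred_coprime : PrimrecPred fun p : ℕ × ℕ => p.1.Coprime p.2 := by
  have h1 : PrimrecRel fun (d : ℕ) (p : ℕ × ℕ) => d ≤ 1 ∨ ¬ (p.1 % d = 0 ∧ p.2 % d = 0) :=
    (Primrec.nat_le.comp Primrec.fst (Primrec.const 1)).or
      (((Primrec.eq.comp (Primrec.nat_mod.comp (Primrec.fst.comp Primrec.snd) Primrec.fst)
        (Primrec.const 0)).and
        (Primrec.eq.comp (Primrec.nat_mod.comp (Primrec.snd.comp Primrec.snd) Primrec.fst)
        (Primrec.const 0))).not)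
  -- The range must contain the gcd, which is at most `m + n`, and also `2`, the common divisor used
  -- when `m = n = 0`.
  have h2 : Primrec fun p : ℕ × ℕ => p.1 + p.2 + 3 := Primrec.nat_add.comp
    (Primrec.nat_add.comp Primrec.fst Primrec.snd) (Primrec.const 3)
  refine (h1.forall_mem_list.comp (Primrec.list_range.comp h2) Primrec.id).of_eq ?_
  rintro ⟨m, n⟩
  simp only [id, List.mem_range, ← Nat.dvd_iff_mod_eq_zero]
  constructor
  · intro h
    by_contra hc
    by_cases h0 : m = 0 ∧ n = 0
    · rcases h 2 (by omega) with h2 | h2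
      · omega
      · exact h2 (by simp [h0])
    · have hle : m.gcd n ≤ m + n := by
        rcases Nat.eq_zero_or_pos m with hm | hm
        · simp [hm]
        · exact (Nat.gcd_le_left n hm).trans (by omega)
      rcases h (m.gcd n) (by omega) with h2 | h2
      · have : m.gcd n ≠ 0 := fun h => h0 (Nat.gcd_eq_zero_iff.1 h)
        exact hc (show m.gcd n = 1 by omega)
      · exact h2 ⟨Nat.gcd_dvd_left m n, Nat.gcd_dvd_right m n⟩
  · intro h d _
    by_contra! hd
    exact hd.1.not_ge (Nat.le_of_dvd one_pos (h ▸ Nat.dvd_gcd hd.2.1 hd.2.2))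

/-! ### Reduced words in the letters of finite order -/

namespace IntMat

theorem apply_mul (M N : IntMat) (v : ℤ × ℤ) : IntMat.apply (M * N) v = M.apply (N.apply v) := by
  simp only [IntMat.apply, Matrix.mul_apply, Fin.sum_univ_two]
  ext <;> ring

theorem apply_one (v : ℤ × ℤ) : IntMat.apply 1 v = v := by
  simp [IntMat.apply]

/-- The elements of the cyclic group of order four generated by `S`. -/
def fourLetters : List IntMat :=
  [!![1, 0; 0, 1], !![-1, 0; 0, -1], !![0, -1; 1, 0], !![0, 1; -1, 0]]

/-- The elements of the cyclic group of order six generated by `-R`, where `R` has order three. -/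
def sixLetters : List IntMat :=
  [!![1, 0; 0, 1], !![-1, 0; 0, -1], !![0, 1; -1, -1], !![0, -1; 1, 1], !![-1, -1; 1, 0],
    !![1, 1; -1, 0]]

/-- An element of one of the two amalgamated factors of `SL(2,ℤ)`. -/
def IsLetter (g : IntMat) : Prop := g ∈ fourLetters ∨ g ∈ sixLetters

/-- Two letters are compatible if they lie in a common factor. -/
def Compatible (g h : IntMat) : Prop :=
  (g ∈ fourLetters ∧ h ∈ fourLetters) ∨ (g ∈ sixLetters ∧ h ∈ sixLetters)

theorem mul_mem_fourLetters : ∀ g ∈ fourLetters, ∀ h ∈ fourLetters, g * h ∈ fourLetters := by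
  decide

theorem mul_mem_sixLetters : ∀ g ∈ sixLetters, ∀ h ∈ sixLetters, g * h ∈ sixLetters := by
  decide

theorem Compatible.isLetter_mul {g h : IntMat} (H : Compatible g h) : IsLetter (g * h) :=
  H.imp (fun H => mul_mem_fourLetters g H.1 h H.2) (fun H => mul_mem_sixLetters g H.1 h H.2)

theorem isLetter_one : IsLetter 1 := by
  unfold IsLetter
  decide

theorem IsLetter.exists_inv {g : IntMat} (hg : IsLetter g) : ∃ h, IsLetter h ∧ h * g = 1 := by
  have h4 : ∀ g ∈ fourLetters, ∃ h ∈ fourLetters, h * g = 1 := by decide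
  have h6 : ∀ g ∈ sixLetters, ∃ h ∈ sixLetters, h * g = 1 := by decide
  rcases hg with hg | hg
  · obtain ⟨h, hh, e⟩ := h4 g hg
    exact ⟨h, Or.inl hh, e⟩
  · obtain ⟨h, hh, e⟩ := h6 g hg
    exact ⟨h, Or.inr hh, e⟩

/-- Base case of the ping-pong. It takes two letters, because a letter of order four only permutes
coordinates up to sign and cannot increase the norm by itself. -/
theorem growth_pair_four : ∀ g ∈ fourLetters, ∀ h ∈ sixLetters, g ∉ sixLetters → h ∉ fourLetters →
    0 < (IntMat.apply (g * h) (1, 1)).1 * (IntMat.apply (g * h) (1, 1)).2 ∧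
      2 < |(IntMat.apply (g * h) (1, 1)).1| + |(IntMat.apply (g * h) (1, 1)).2| := by
  decide

theorem growth_pair_six : ∀ g ∈ sixLetters, ∀ h ∈ fourLetters, g ∉ fourLetters → h ∉ sixLetters →
    (IntMat.apply (g * h) (1, -1)).1 * (IntMat.apply (g * h) (1, -1)).2 < 0 ∧
      2 < |(IntMat.apply (g * h) (1, -1)).1| + |(IntMat.apply (g * h) (1, -1)).2| := by
  decide

theorem growth_step_four {g : IntMat} (hg : g ∈ fourLetters) (hg' : g ∉ sixLetters) {v : ℤ × ℤ}
    (hv : v.1 * v.2 < 0) (hv2 : 2 < |v.1| + |v.2|) :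
    0 < (g.apply v).1 * (g.apply v).2 ∧ 2 < |(g.apply v).1| + |(g.apply v).2| := by
  simp only [fourLetters, List.mem_cons, List.not_mem_nil, or_false] at hg
  rcases hg with rfl | rfl | rfl | rfl
  · exact absurd (by decide) hg'
  · exact absurd (by decide) hg'
  all_goals
    simp [IntMat.apply]
    exact ⟨by linarith, by linarith⟩

/-- The coordinates of the image are, up to sign and order, `x + y` and one of `x`, `y`. Equal signs
of `x` and `y` give `|x + y| = |x| + |y|`, so the norm does not drop. -/
theorem growth_step_six {g : IntMat} (hg : g ∈ sixLetters) (hg' : g ∉ fourLetters) {v : ℤ × ℤ}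
    (hv : 0 < v.1 * v.2) (hv2 : 2 < |v.1| + |v.2|) :
    (g.apply v).1 * (g.apply v).2 < 0 ∧ 2 < |(g.apply v).1| + |(g.apply v).2| := by
  obtain ⟨x, y⟩ := v
  simp only [sixLetters, List.mem_cons, List.not_mem_nil, or_false] at hg
  have hs : |x| + |y| = |x + y| := by
    rcases mul_pos_iff.1 hv with h | h
    · rw [abs_of_pos h.1, abs_of_pos h.2, abs_of_pos (by linarith [h.1, h.2])]
    · rw [abs_of_neg h.1, abs_of_neg h.2, abs_of_neg (by linarith [h.1, h.2])]
      ring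
  have hs' : |-x + -y| = |x + y| := by rw [← neg_add, abs_neg]
  dsimp only at hv hv2
  have hx := abs_nonneg x
  have hy := abs_nonneg y
  rcases hg with rfl | rfl | rfl | rfl | rfl | rfl
  · exact absurd (by decide) hg'
  · exact absurd (by decide) hg'
  all_goals
    simp [IntMat.apply]
    exact ⟨by nlinarith [sq_nonneg x, sq_nonneg y], by linarith⟩

/-- Ping-pong: a reduced word of length at least two moves a short vector to a longer one. -/
theorem growth_of_reduced (g : IntMat) (w : List IntMat) (hw : w ≠ [])
    (hc : (g :: w).IsChain fun g h => ¬ Compatible g h) (hl : ∀ h ∈ g :: w, IsLetter h) :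
    ∃ v : ℤ × ℤ, |v.1| + |v.2| = 2 ∧
      (g ∈ fourLetters → 0 < (IntMat.apply (g :: w).prod v).1 * (IntMat.apply (g :: w).prod v).2) ∧
      (g ∈ sixLetters → (IntMat.apply (g :: w).prod v).1 * (IntMat.apply (g :: w).prod v).2 < 0) ∧
      2 < |(IntMat.apply (g :: w).prod v).1| + |(IntMat.apply (g :: w).prod v).2| := by
  induction w generalizing g with
  | nil => exact absurd rfl hw
  | cons h w ih =>
    rw [List.isChain_cons_cons] at hc
    have hcomp := hc.1
    unfold Compatible at hcomp
    have hgl : IsLetter g := hl g (by simp)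
    have hhl : IsLetter h := hl h (by simp)
    -- Neither neighbour is `±1`, since these lie in both factors and are compatible with every
    -- letter; so the factors alternate.
    have key : (g ∈ fourLetters ∧ g ∉ sixLetters ∧ h ∈ sixLetters ∧ h ∉ fourLetters) ∨
        (g ∈ sixLetters ∧ g ∉ fourLetters ∧ h ∈ fourLetters ∧ h ∉ sixLetters) := by
      unfold IsLetter at hgl hhl
      tauto
    rcases eq_or_ne w [] with rfl | hne
    · simp only [List.prod_cons, List.prod_nil, mul_one]
      rcases key with ⟨h1, h2, h3, h4⟩ | ⟨h1, h2, h3, h4⟩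
      · have := growth_pair_four g h1 h h3 h2 h4
        exact ⟨(1, 1), by decide, fun _ => this.1, fun h => absurd h h2, this.2⟩
      · have := growth_pair_six g h1 h h3 h2 h4
        exact ⟨(1, -1), by decide, fun h => absurd h h2, fun _ => this.1, this.2⟩
    · obtain ⟨v, hv, hv4, hv6, hv2⟩ := ih h hne hc.2 fun k hk => hl k (List.mem_cons_of_mem _ hk)
      simp only [List.prod_cons (a := g) (l := h :: w), apply_mul]
      rcases key with ⟨h1, h2, h3, h4⟩ | ⟨h1, h2, h3, h4⟩
      · have := growth_step_four h1 h2 (hv6 h3) hv2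
        exact ⟨v, hv, fun _ => this.1, fun h => absurd h h2, this.2⟩
      · have := growth_step_six h1 h2 (hv4 h3) hv2
        exact ⟨v, hv, fun h => absurd h h2, fun _ => this.1, this.2⟩

/-! ### Paths in labelled graphs -/

/-- `w` labels a path from `p` to `q` in the labelled graph `E`. -/
def IsPath {σ : Type*} (E : σ → IntMat → σ → Prop) : σ → List IntMat → σ → Prop
  | p, [], q => p = q
  | p, g :: w, q => ∃ r, E p g r ∧ IsPath E r w q

theorem isPath_append {σ : Type*} {E : σ → IntMat → σ → Prop} {p q : σ} {u v : List IntMat} :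
    IsPath E p (u ++ v) q ↔ ∃ r, IsPath E p u r ∧ IsPath E r v q := by
  induction u generalizing p with
  | nil => simp [IsPath]
  | cons g u ih =>
    simp only [List.cons_append, IsPath, ih]
    tauto

/-- In a graph closed under composition of compatible labels, a nonempty path whose label is the
identity can be replaced by an edge. -/
theorem IsPath.edge_of_prod_eq_one {σ : Type*} {E : σ → IntMat → σ → Prop}
    (hl : ∀ p g q, E p g q → IsLetter g)
    (hE : ∀ p g q h r, E p g q → E q h r → Compatible g h → E p (g * h) r) {p q : σ} :
    ∀ {w : List IntMat}, w ≠ [] → IsPath E p w q → w.prod = 1 → E p 1 q := by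
  intro w
  induction hn : w.length using Nat.strong_induction_on generalizing w with
  | _ n ih =>
    intro hw hp h1
    have hlet : ∀ (u : List IntMat) (p : σ), IsPath E p u q → ∀ g ∈ u, IsLetter g := by
      intro u
      induction u with
      | nil => simp
      | cons g u ihu =>
        rintro p ⟨r, hr, hu⟩ k hk
        rcases List.mem_cons.1 hk with rfl | hk
        · exact hl _ _ _ hr
        · exact ihu r hu k hk
    -- A reduced label is a single letter, by the growth of vectors. Otherwise two compatible
    -- neighbours are merged into one edge, which shortens the path.
    by_cases hc : w.IsChain fun g h => ¬ Compatible g h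
    · match w, hw with
      | [g], _ =>
        obtain ⟨r, hr, rfl⟩ := hp
        rw [List.prod_singleton] at h1
        exact h1 ▸ hr
      | g :: h :: u, _ =>
        obtain ⟨v, hv, -, -, hv2⟩ := growth_of_reduced g (h :: u) (by simp) hc (hlet _ p hp)
        rw [h1, apply_one] at hv2
        omega
    · rw [List.isChain_iff_forall_rel_of_append_cons_cons] at hc
      push Not at hc
      obtain ⟨g, h, u, v, rfl, hgh⟩ := hc
      refine ih (u ++ g * h :: v).length ?_ rfl (by simp) ?_ ?_
      · rw [← hn]
        simp
      · obtain ⟨r, hu, s, hg, t, hh, hv⟩ := isPath_append.1 hp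
        exact isPath_append.2 ⟨r, hu, t, hE _ _ _ _ _ hg hh hgh, hv⟩
      · rw [← h1]
        simp [mul_assoc]

/-! ### Unipotent matrices and factorization into letters -/

/-- The upper unipotent matrices. -/
def upper (k : ℤ) : IntMat := !![1, k; 0, 1]

theorem upper_mul (k l : ℤ) : upper k * upper l = upper (k + l) := by
  simp [upper, add_comm]

theorem upper_apply (k d : ℤ) : (upper k).apply (d, 0) = (d, 0) := by
  simp [upper, IntMat.apply]

theorem mem_closure_upper {P : IntMat} :
    P ∈ Submonoid.closure {upper 1, upper (-1)} ↔ ∃ k, P = upper k := by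
  constructor
  · intro h
    induction h using Submonoid.closure_induction with
    | mem x hx => rcases hx with rfl | rfl <;> exact ⟨_, rfl⟩
    | one => exact ⟨0, by simp [upper, Matrix.one_fin_two]⟩
    | mul x y _ _ hx hy =>
      obtain ⟨⟨k, rfl⟩, l, rfl⟩ := And.intro hx hy
      exact ⟨k + l, upper_mul k l⟩
  · have hz : upper 0 = 1 := by simp [upper, Matrix.one_fin_two]
    rintro ⟨k, rfl⟩
    induction k using Int.induction_on with
    | zero => exact hz ▸ one_mem _
    | succ n ih => exact upper_mul n 1 ▸ mul_mem ih (Submonoid.subset_closure (by simp))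
    | pred n ih =>
      rw [sub_eq_add_neg, ← upper_mul]
      exact mul_mem ih (Submonoid.subset_closure (by simp))

/-- `M` is a product of letters. -/
def IsWord (M : IntMat) : Prop := ∃ w : List IntMat, (∀ g ∈ w, IsLetter g) ∧ w.prod = M

theorem IsLetter.isWord {g : IntMat} (hg : IsLetter g) : IsWord g :=
  ⟨[g], by simpa using hg, by simp⟩

theorem IsWord.mul {M N : IntMat} (hM : IsWord M) (hN : IsWord N) : IsWord (M * N) := by
  obtain ⟨⟨u, hu, rfl⟩, v, hv, rfl⟩ := And.intro hM hN
  exact ⟨u ++ v, fun g hg => (List.mem_append.1 hg).elim (hu g) (hv g), by simp⟩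

/-- `S` is a letter and `T` is `S` times a letter of order three; inverses of words are words
because both factors are groups. -/
theorem isWord_coe (M : SL(2, ℤ)) : IsWord (M : IntMat) := by
  have hM : M ∈ Subgroup.closure {ModularGroup.S, ModularGroup.T} := by
    rw [SpecialLinearGroup.SL2Z_generators]
    trivial
  have hinv : ∀ w : List IntMat, (∀ g ∈ w, IsLetter g) → ∃ N, IsWord N ∧ N * w.prod = 1 := by
    intro w
    induction w with
    | nil => exact fun _ => ⟨1, isLetter_one.isWord, by simp⟩
    | cons g w ih =>
      intro hw
      obtain ⟨N, hN, e⟩ := ih fun k hk => hw k (List.mem_cons_of_mem _ hk)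
      obtain ⟨h, hh, e'⟩ := (hw g (by simp)).exists_inv
      refine ⟨N * h, hN.mul hh.isWord, ?_⟩
      rw [List.prod_cons, mul_assoc, ← mul_assoc h, e', one_mul, e]
  induction hM using Subgroup.closure_induction with
  | mem x hx =>
    rcases hx with rfl | rfl
    · exact IsLetter.isWord (by rw [ModularGroup.coe_S]; unfold IsLetter; decide)
    · rw [ModularGroup.coe_T, show (!![1, 1; 0, 1] : IntMat) = !![0, -1; 1, 0] * !![0, 1; -1, -1] by
        decide]
      exact IsWord.mul (IsLetter.isWord (by unfold IsLetter; decide))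
        (IsLetter.isWord (by unfold IsLetter; decide))
  | one => simpa using isLetter_one.isWord
  | mul x y _ _ hx hy => simpa using hx.mul hy
  | inv x _ hx =>
    obtain ⟨w, hw, e⟩ := hx
    obtain ⟨N, hN, e'⟩ := hinv w hw
    rw [e] at e'
    have h2 : (x : IntMat) * ((x⁻¹ : SL(2, ℤ)) : IntMat) = 1 := by
      rw [← Matrix.SpecialLinearGroup.coe_mul, mul_inv_cancel, Matrix.SpecialLinearGroup.coe_one]
    rwa [← left_inv_eq_right_inv e' h2]

theorem isWord_of_det_eq_one {M : IntMat} (hM : M.det = 1) : IsWord M :=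
  isWord_coe ⟨M, hM⟩

end IntMat

/-! ### Saturated automata -/

namespace IntMat

/-- A state `(b, w)` of an automaton: the word `w` has to be read before the base state `b` is
reached. -/
abbrev State := ℕ × List IntMat

/-- An edge of an automaton: its source, its label and its target. -/
abbrev Edge := State × IntMat × State

/-- There is an edge labelled by the identity from the base state `b` to a state which reads a word
with product `M` and then reaches the base state `b'`. -/
def HasWord (L : List Edge) (b b' : ℕ) (M : IntMat) : Prop :=
  ∃ e ∈ L, e.1 = (b, []) ∧ e.2.1 = 1 ∧ e.2.2.1 = b' ∧ e.2.2.2.prod = M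

/-- All labels are letters, edges with compatible labels can be composed, and a state that is
reached reads the first letter of its word. -/
def IsSaturated (L : List Edge) : Prop :=
  (∀ e ∈ L, IsLetter e.2.1) ∧
    (∀ e ∈ L, ∀ e' ∈ L, ¬ (e.2.2 = e'.1 ∧ Compatible e.2.1 e'.2.1) ∨
      (e.1, e.2.1 * e'.2.1, e'.2.2) ∈ L) ∧
    ∀ e ∈ L, e.2.2.2 = [] ∨ (e.2.2, e.2.2.2.headI, (e.2.2.1, e.2.2.2.tail)) ∈ L

/-- The saturated automaton `L` shows that no product `M * A * P * B` with `M` in the monoid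
generated by `Ms` and `P` upper unipotent is the identity. -/
def Separates (Ms : List IntMat) (A B : IntMat) (L : List Edge) : Prop :=
  IsSaturated L ∧ (∀ M ∈ Ms, HasWord L 0 0 M) ∧ HasWord L 0 1 A ∧ HasWord L 1 1 (upper 1) ∧
    HasWord L 1 1 (upper (-1)) ∧ HasWord L 1 2 B ∧ ((0, []), 1, (2, [])) ∉ L

/-- Some path from the base state `b` to the base state `b'` has a label with product `M`. -/
def Connects (L : List Edge) (b b' : ℕ) (M : IntMat) : Prop :=
  ∃ u, IsPath (fun p g q => (p, g, q) ∈ L) (b, []) u (b', []) ∧ u.prod = M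

theorem Connects.mul {L : List Edge} {b b' b'' : ℕ} {M N : IntMat} (hM : Connects L b b' M)
    (hN : Connects L b' b'' N) : Connects L b b'' (M * N) := by
  obtain ⟨⟨u, hu, rfl⟩, v, hv, rfl⟩ := And.intro hM hN
  exact ⟨u ++ v, isPath_append.2 ⟨_, hu, hv⟩, List.prod_append⟩

/-- The last clause of saturation lets the pending word be read letter by letter after the initial
identity edge. -/
theorem HasWord.connects {L : List Edge} (hL : IsSaturated L) {b b' : ℕ} {M : IntMat}
    (h : HasWord L b b' M) : Connects L b b' M := by
  have key : ∀ (w : List IntMat) (p : State) (g : IntMat), (p, g, (b', w)) ∈ L →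
      IsPath (fun p g q => (p, g, q) ∈ L) (b', w) w (b', []) := by
    intro w
    induction w with
    | nil => exact fun _ _ _ => rfl
    | cons k w ih =>
      intro p g hp
      have h3 := (hL.2.2 _ hp).resolve_left (by simp)
      exact ⟨_, h3, ih _ _ h3⟩
  obtain ⟨⟨p, g, c, w⟩, he, h1, h2, h3, h4⟩ := h
  dsimp only at h1 h2 h3 h4
  subst h1 h2 h3 h4
  exact ⟨1 :: w, ⟨_, he, key w _ _ he⟩, by simp⟩

theorem connects_of_mem_closure {L : List Edge} {b : ℕ} {X : Set IntMat}
    (hX : ∀ M ∈ X, Connects L b b M) {M : IntMat} (hM : M ∈ Submonoid.closure X) :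
    Connects L b b M := by
  induction hM using Submonoid.closure_induction with
  | mem x hx => exact hX x hx
  | one => exact ⟨[], rfl, rfl⟩
  | mul x y _ _ hx hy => exact hx.mul hy

/-- Soundness: loops at `0` read `M`, loops at `1` read `upper k`, and `A`, `B` lead from `0` to `1`
to `2`. A product equal to `1` would collapse this path to the forbidden edge. -/
theorem Separates.ne_one {Ms : List IntMat} {A B : IntMat} {L : List Edge}
    (h : Separates Ms A B L) {M : IntMat} (hM : M ∈ Submonoid.closure {M | M ∈ Ms}) (k : ℤ) :
    M * A * upper k * B ≠ 1 := by
  obtain ⟨hL, hMs, hA, hT, hT', hB, hf⟩ := h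
  intro h1
  have hP : Connects L 1 1 (upper k) := by
    refine connects_of_mem_closure ?_ (mem_closure_upper.2 ⟨k, rfl⟩)
    rintro _ (rfl | rfl)
    exacts [hT.connects hL, hT'.connects hL]
  obtain ⟨u, hu, hu1⟩ := (((connects_of_mem_closure (fun N hN => (hMs N hN).connects hL) hM).mul
    (hA.connects hL)).mul hP).mul (hB.connects hL)
  refine hf (IsPath.edge_of_prod_eq_one (E := fun p g q => (p, g, q) ∈ L)
    (fun p g q h => hL.1 _ h) ?_ ?_ hu (hu1.trans h1))
  · intro p g q h r hg hh hgh
    exact (hL.2.1 _ hg _ hh).resolve_left (fun hn => hn ⟨rfl, hgh⟩)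
  · rintro rfl
    simp [IsPath] at hu

/-- The steps of the automaton that reads the words of `W`. -/
def Step (W : List (ℕ × ℕ × List IntMat)) (p : State) (g : IntMat) (q : State) : Prop :=
  (p.2 = [] ∧ g = 1 ∧ (p.1, q.1, q.2) ∈ W) ∨ (p.2 = g :: q.2 ∧ p.1 = q.1)

/-- The states of the automaton that reads the words of `W`. -/
def states (W : List (ℕ × ℕ × List IntMat)) : Set State :=
  {p | (∃ e ∈ W, p.1 = e.1 ∨ p.1 = e.2.1) ∧ ∃ e ∈ W, p.2 <:+ e.2.2}

theorem finite_states (W : List (ℕ × ℕ × List IntMat)) : (states W).Finite := by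
  refine Set.Finite.subset (Set.Finite.prod
    (List.finite_toSet (W.flatMap fun e => [e.1, e.2.1]))
    (List.finite_toSet (W.flatMap fun e => e.2.2.tails))) ?_
  rintro ⟨b, w⟩ ⟨⟨e, he, hb⟩, e', he', hw⟩
  simp only [Set.mem_prod, Set.mem_ofPred_eq, List.mem_flatMap, List.mem_tails]
  exact ⟨⟨e, he, by simpa using hb⟩, e', he', hw⟩

theorem finite_isLetter : {g : IntMat | IsLetter g}.Finite :=
  (List.finite_toSet fourLetters).union (List.finite_toSet sixLetters)

/-- The edges labelled by the letters that are products of paths of `Step W` form a saturated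
automaton. -/
theorem exists_saturated (W : List (ℕ × ℕ × List IntMat))
    (hW : ∀ e ∈ W, ∀ g ∈ e.2.2, IsLetter g) :
    ∃ L : List Edge, IsSaturated L ∧ (∀ e ∈ W, HasWord L e.1 e.2.1 e.2.2.prod) ∧
      ∀ e ∈ L, ∃ u, IsPath (Step W) e.1 u e.2.2 ∧ u.prod = e.2.1 := by
  let X : Set Edge := {e | e.1 ∈ states W ∧ IsLetter e.2.1 ∧ e.2.2 ∈ states W ∧
    ∃ u, IsPath (Step W) e.1 u e.2.2 ∧ u.prod = e.2.1}
  have hX : X.Finite := ((finite_states W).prod (finite_isLetter.prod (finite_states W))).subset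
    fun e he => ⟨he.1, he.2.1, he.2.2.1⟩
  have hmem (e : Edge) : e ∈ hX.toFinset.toList ↔ e ∈ X := by simp
  refine ⟨hX.toFinset.toList, ⟨?_, ?_, ?_⟩, ?_, ?_⟩
  · intro e he
    exact ((hmem e).1 he).2.1
  · rintro ⟨p, g, q⟩ he ⟨q', h, r⟩ he'
    rw [or_iff_not_imp_left, not_not]
    rintro ⟨hq, hgh⟩
    dsimp only at hq hgh
    subst hq
    obtain ⟨hp, -, -, u, hu, hu1⟩ := (hmem _).1 he
    obtain ⟨-, -, hr, v, hv, hv1⟩ := (hmem _).1 he'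
    exact (hmem _).2 ⟨hp, hgh.isLetter_mul, hr, u ++ v, isPath_append.2 ⟨_, hu, hv⟩, by
      rw [List.prod_append, hu1, hv1]⟩
  · rintro ⟨p, g, b, w⟩ he
    obtain ⟨-, -, ⟨hb, e, heW, hs⟩, -⟩ := (hmem _).1 he
    rcases w with _ | ⟨h, w⟩
    · exact Or.inl rfl
    · refine Or.inr ((hmem _).2 ⟨⟨hb, e, heW, hs⟩, hW e heW h (hs.subset (by simp)),
        ⟨hb, e, heW, (List.suffix_cons h w).trans hs⟩, [h],
        ⟨(b, w), Or.inr ⟨rfl, rfl⟩, rfl⟩, by simp⟩)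
  · intro e he
    refine ⟨((e.1, []), 1, (e.2.1, e.2.2)), (hmem _).2 ⟨⟨⟨e, he, Or.inl rfl⟩, e, he,
      List.nil_suffix⟩, isLetter_one, ⟨⟨e, he, Or.inr rfl⟩, e, he, List.suffix_rfl⟩, [1],
      ⟨_, Or.inl ⟨rfl, rfl, he⟩, rfl⟩, by simp⟩, rfl, rfl, rfl, rfl⟩
  · intro e he
    exact ((hmem e).1 he).2.2.2

/-- Completeness: in the automaton of `exists_saturated` every edge is the product of an actual
path, so the forbidden edge would exhibit a product equal to `1`. -/
theorem exists_separates {Ms : List IntMat} {A B : IntMat} (hMs : ∀ M ∈ Ms, M.det = 1)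
    (hA : A.det = 1) (hB : B.det = 1)
    (h : ∀ M ∈ Submonoid.closure {M | M ∈ Ms}, ∀ k, M * A * upper k * B ≠ 1) :
    ∃ L, Separates Ms A B L := by
  have hword (M : IntMat) : ∃ w : List IntMat, M.det = 1 → (∀ g ∈ w, IsLetter g) ∧ w.prod = M := by
    by_cases hM : M.det = 1
    · obtain ⟨w, hw⟩ := isWord_of_det_eq_one hM
      exact ⟨w, fun _ => hw⟩
    · exact ⟨[], fun h => absurd h hM⟩
  choose w hw using hword
  have hup (k : ℤ) : (upper k).det = 1 := by simp [upper]
  let W : List (ℕ × ℕ × List IntMat) := [(0, 1, w A), (1, 1, w (upper 1)), (1, 1, w (upper (-1))),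
    (1, 2, w B)] ++ Ms.map fun M => (0, 0, w M)
  have hW (e) : e ∈ W ↔ (e = (0, 1, w A) ∨ e = (1, 1, w (upper 1)) ∨ e = (1, 1, w (upper (-1))) ∨
      e = (1, 2, w B)) ∨ ∃ M ∈ Ms, (0, 0, w M) = e := by
    simp only [W, List.mem_append, List.mem_cons, List.not_mem_nil, or_false, List.mem_map]
  obtain ⟨L, hL, hLW, hLu⟩ := exists_saturated W (by
    intro e he
    rcases (hW e).1 he with (rfl | rfl | rfl | rfl) | ⟨M, hM, rfl⟩
    exacts [(hw _ hA).1, (hw _ (hup 1)).1, (hw _ (hup (-1))).1, (hw _ hB).1,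
      (hw _ (hMs M hM)).1])
  have hLW' {b b' : ℕ} {M : IntMat} (hM : M.det = 1) (h : (b, b', w M) ∈ W) : HasWord L b b' M := by
    have := hLW _ h
    rwa [(hw M hM).2] at this
  refine ⟨L, hL, fun M hM => hLW' (hMs M hM) ((hW _).2 (Or.inr ⟨M, hM, rfl⟩)),
    hLW' hA (by simp [W]), hLW' (hup 1) (by simp [W]), hLW' (hup (-1)) (by simp [W]),
    hLW' hB (by simp [W]), fun hmem => ?_⟩
  obtain ⟨u, hu, hu1⟩ := hLu _ hmem
  dsimp only at hu hu1
  -- the products that can still be read from a base state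
  let Val : ℕ → IntMat → Prop := fun b N =>
    (b = 0 ∧ ∃ M ∈ Submonoid.closure {M | M ∈ Ms}, ∃ k, N = M * A * upper k * B) ∨
      (b = 1 ∧ ∃ k, N = upper k * B) ∨ (b = 2 ∧ N = 1)
  have hz : upper 0 = 1 := by simp [upper, Matrix.one_fin_two]
  have v0 (N) : Val 0 N ↔ ∃ M ∈ Submonoid.closure {M | M ∈ Ms}, ∃ k, N = M * A * upper k * B := by
    simp [Val]
  have v1 (N) : Val 1 N ↔ ∃ k, N = upper k * B := by simp [Val]
  have v2 (N) : Val 2 N ↔ N = 1 := by simp [Val]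
  have hval : ∀ e ∈ W, ∀ N, Val e.2.1 N → Val e.1 (e.2.2.prod * N) := by
    intro e he N hN
    rcases (hW e).1 he with (rfl | rfl | rfl | rfl) | ⟨M, hM, rfl⟩
    · obtain ⟨k, rfl⟩ := (v1 _).1 hN
      exact (v0 _).2 ⟨1, one_mem _, k, by simp only [(hw A hA).2, one_mul, mul_assoc]⟩
    · obtain ⟨k, rfl⟩ := (v1 _).1 hN
      exact (v1 _).2 ⟨1 + k, by simp only [(hw _ (hup 1)).2, ← mul_assoc, upper_mul]⟩
    · obtain ⟨k, rfl⟩ := (v1 _).1 hN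
      exact (v1 _).2 ⟨-1 + k, by simp only [(hw _ (hup (-1))).2, ← mul_assoc, upper_mul]⟩
    · obtain rfl := (v2 _).1 hN
      exact (v1 _).2 ⟨0, by simp only [(hw _ hB).2, hz, one_mul, mul_one]⟩
    · obtain ⟨M', hM', k, rfl⟩ := (v0 _).1 hN
      exact (v0 _).2 ⟨M * M', mul_mem (Submonoid.subset_closure hM) hM', k, by
        simp only [(hw M (hMs M hM)).2, mul_assoc]⟩
  -- Reading from a state first completes its pending word and then continues from its base state.
  have key : ∀ (u : List IntMat) (p : State), IsPath (Step W) p u (2, []) →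
      ∃ N, Val p.1 N ∧ u.prod = p.2.prod * N := by
    intro u
    induction u with
    | nil =>
      rintro p rfl
      exact ⟨1, (v2 _).2 rfl, by simp⟩
    | cons g u ih =>
      rintro p ⟨q, hpq, hq⟩
      obtain ⟨N, hN, e⟩ := ih q hq
      rcases hpq with ⟨h1, rfl, h3⟩ | ⟨h1, h2⟩
      · refine ⟨q.2.prod * N, hval _ h3 N hN, by simp [h1, e]⟩
      · exact ⟨N, h2 ▸ hN, by rw [List.prod_cons, e, h1, List.prod_cons, mul_assoc]⟩
  obtain ⟨N, hN, e⟩ := key u _ hu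
  obtain ⟨M, hM, k, rfl⟩ := (v0 _).1 hN
  exact h M hM k (by rw [← hu1, e, List.prod_nil, one_mul])

end IntMat

/-! ### The vector reachability problem -/

namespace IntMat

/-- `d` is the gcd of the coordinates; for `d ≠ 0` the first column of `A` is `x / d` and Bézout
coefficients fill the second. -/
theorem exists_primitive (x : ℤ × ℤ) :
    ∃ (A : IntMat) (d : ℕ), A.det = 1 ∧ IntMat.apply A (d, 0) = x := by
  obtain ⟨a, b⟩ := x
  rcases eq_or_ne (Int.gcd a b) 0 with h0 | h0
  · obtain ⟨rfl, rfl⟩ := Int.gcd_eq_zero_iff.1 h0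
    exact ⟨1, 0, Matrix.det_one, by simp [apply_one]⟩
  · obtain ⟨a', ha⟩ := Int.gcd_dvd_left a b
    obtain ⟨b', hb⟩ := Int.gcd_dvd_right a b
    have hbez := Int.gcd_eq_gcd_ab a b
    refine ⟨!![a', -Int.gcdB a b; b', Int.gcdA a b], Int.gcd a b, ?_, ?_⟩
    · rw [Matrix.det_fin_two_of]
      have h0' : (Int.gcd a b : ℤ) ≠ 0 := by exact_mod_cast h0
      refine mul_left_cancel₀ h0' ?_
      linear_combination (-1 : ℤ) * hbez - Int.gcdA a b * ha - Int.gcdB a b * hb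
    · simp only [IntMat.apply, Matrix.of_apply, Matrix.cons_val', Matrix.cons_val_zero,
        Matrix.cons_val_one, Matrix.cons_val_fin_one, mul_zero, add_zero]
      rw [mul_comm a', mul_comm b', ← ha, ← hb]

theorem exists_mul_eq_one {A : IntMat} (hA : A.det = 1) :
    ∃ B : IntMat, B.det = 1 ∧ B * A = 1 ∧ A * B = 1 :=
  ⟨A.adjugate, by rw [Matrix.det_adjugate, hA, one_pow], by rw [Matrix.adjugate_mul, hA, one_smul],
    by rw [Matrix.mul_adjugate, hA, one_smul]⟩

theorem det_of_mem_closure {Ms : List IntMat} (hMs : ∀ M ∈ Ms, M.det = 1) {M : IntMat}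
    (hM : M ∈ Submonoid.closure {M | M ∈ Ms}) : M.det = 1 := by
  induction hM using Submonoid.closure_induction with
  | mem x hx => exact hMs x hx
  | one => exact Matrix.det_one
  | mul x y _ _ hx hy => rw [Matrix.det_mul, hx, hy, one_mul]

/-- The data certifying that the target vector cannot be reached: matrices `A` and `B` that bring
source and target to the form `(d, 0)`, the two numbers `d`, and a saturated automaton. -/
abbrev Certificate := (IntMat × IntMat) × (ℕ × ℕ) × List Edge

/-- `z` certifies that the vector `v.2` cannot be reached from `v.1`. -/
def Refutes (v : (ℤ × ℤ) × (ℤ × ℤ)) (Ms : List IntMat) (z : Certificate) : Prop :=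
  (z.1.1.det = 1 ∧ z.1.2.det = 1) ∧
    (IntMat.apply z.1.1 ((z.2.1.1 : ℤ), 0) = v.1 ∧
      IntMat.apply z.1.2 v.2 = ((z.2.1.2 : ℤ), 0)) ∧
    (z.2.1.1 ≠ z.2.1.2 ∨ (z.2.1.1 ≠ 0 ∧ Separates Ms z.1.1 z.1.2 z.2.2))

/-- For `d ≠ 0` the matrix is upper triangular with diagonal `±1`; taking `d` and `d'` natural
excludes the sign `-1`. -/
theorem eq_of_apply {N : IntMat} (hN : N.det = 1) {d d' : ℕ}
    (h : IntMat.apply N ((d : ℤ), 0) = ((d' : ℤ), 0)) :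
    d = d' ∧ (d ≠ 0 → ∃ k, N = upper k) := by
  rw [Matrix.det_fin_two] at hN
  simp only [IntMat.apply, mul_zero, add_zero, Prod.mk.injEq] at h
  obtain ⟨h1, h2⟩ := h
  rcases Nat.eq_zero_or_pos d with rfl | hd
  · simp only [Nat.cast_zero, mul_zero] at h1
    exact ⟨by exact_mod_cast h1, fun h => absurd rfl h⟩
  · have h10 : N 1 0 = 0 := by
      rcases mul_eq_zero.1 h2 with h | h
      · exact h
      · omega
    rw [h10, mul_zero, sub_zero] at hN
    have h00 : N 0 0 = 1 := by
      rcases Int.mul_eq_one_iff_eq_one_or_neg_one.1 hN with h | h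
      · exact h.1
      · rw [h.1] at h1
        omega
    rw [h00, one_mul] at hN h1
    refine ⟨by exact_mod_cast h1, fun _ => ⟨N 0 1, ?_⟩⟩
    rw [Matrix.eta_fin_two N, h00, h10, hN]
    rfl

theorem not_reachable_iff {v : (ℤ × ℤ) × (ℤ × ℤ)} {Ms : List IntMat}
    (hMs : ∀ M ∈ Ms, M.det = 1) :
    (¬ ∃ M ∈ Submonoid.closure {M | M ∈ Ms}, IntMat.apply M v.1 = v.2) ↔
      ∃ z, Refutes v Ms z := by
  obtain ⟨x, y⟩ := v
  constructor
  · intro hn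
    obtain ⟨A, d, hA, hx⟩ := exists_primitive x
    obtain ⟨A', d', hA', hy⟩ := exists_primitive y
    obtain ⟨B, hB, hBA, hAB⟩ := exists_mul_eq_one hA'
    have hBy : IntMat.apply B y = ((d' : ℤ), 0) := by rw [← hy, ← apply_mul, hBA, apply_one]
    by_cases hd : d = d'
    · subst hd
      have hd0 : d ≠ 0 := by
        rintro rfl
        refine hn ⟨1, one_mem _, ?_⟩
        rw [apply_one]
        dsimp only
        rw [← hx, ← hy]
        simp [IntMat.apply]
      obtain ⟨L, hL⟩ := exists_separates (A := A) (B := B) hMs hA hB (by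
        intro M hM k h1
        refine hn ⟨M, hM, ?_⟩
        have h2 : IntMat.apply (M * A * upper k * B) y = y := by rw [h1, apply_one]
        rw [apply_mul, apply_mul, apply_mul, hBy, upper_apply, hx] at h2
        exact h2)
      exact ⟨((A, B), (d, d), L), ⟨hA, hB⟩, ⟨hx, hBy⟩, Or.inr ⟨hd0, hL⟩⟩
    · exact ⟨((A, B), (d, d'), []), ⟨hA, hB⟩, ⟨hx, hBy⟩, Or.inl hd⟩
  · rintro ⟨⟨⟨A, B⟩, ⟨d, d'⟩, L⟩, ⟨hA, hB⟩, ⟨hx, hy⟩, h⟩ ⟨M, hM, hxy⟩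
    dsimp only at hA hB hx hy h hxy
    have hN : Matrix.det (B * M * A) = 1 := by
      rw [Matrix.det_mul, Matrix.det_mul, hA, hB, det_of_mem_closure hMs hM, one_mul, one_mul]
    obtain ⟨hd, hk⟩ := eq_of_apply hN (d := d) (d' := d') (by
      rw [apply_mul, apply_mul, hx, hxy, hy])
    obtain ⟨hd0, hL⟩ := h.resolve_left (fun h => h hd)
    obtain ⟨k, hk⟩ := hk hd0
    -- From `B * M * A = upper k`, cancel with `upper (-k)` and rotate `B` to the end.
    refine hL.ne_one hM (-k) (mul_eq_one_comm.1 ?_)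
    rw [← mul_assoc, ← mul_assoc, hk, upper_mul]
    simp [upper, Matrix.one_fin_two]

theorem mem_closure_iff_exists_list {Ms : List IntMat} {M : IntMat} :
    M ∈ Submonoid.closure {M | M ∈ Ms} ↔ ∃ w : List IntMat, (∀ N ∈ w, N ∈ Ms) ∧ w.prod = M :=
  ⟨fun h => Submonoid.exists_list_of_mem_closure h, by
    rintro ⟨w, hw, rfl⟩
    exact Submonoid.list_prod_mem _ fun N hN => Submonoid.subset_closure (hw N hN)⟩

/-! ### Certificates can be checked -/

theorem primrecPred_isLetter : PrimrecPred IsLetter :=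
  (primrecRel_mem.comp Primrec.id (Primrec.const fourLetters)).or
    (primrecRel_mem.comp Primrec.id (Primrec.const sixLetters))

theorem primrecRel_compatible : PrimrecRel Compatible := by
  have h (l : List IntMat) : PrimrecPred fun p : IntMat × IntMat => p.1 ∈ l ∧ p.2 ∈ l :=
    (primrecRel_mem.comp Primrec.fst (Primrec.const l)).and
      (primrecRel_mem.comp Primrec.snd (Primrec.const l))
  exact (h fourLetters).or (h sixLetters)

theorem primrecRel_hasWord (b b' : ℕ) : PrimrecRel fun L M => HasWord L b b' M := by
  have h : PrimrecRel fun (e : Edge) (M : IntMat) =>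
      e.1 = (b, []) ∧ e.2.1 = 1 ∧ e.2.2.1 = b' ∧ e.2.2.2.prod = M := by
    have he : Primrec fun p : Edge × IntMat => p.1 := Primrec.fst
    have hq : Primrec fun p : Edge × IntMat => p.1.2.2 := Primrec.snd.comp (Primrec.snd.comp he)
    exact (Primrec.eq.comp (Primrec.fst.comp he) (Primrec.const _)).and
      ((Primrec.eq.comp (Primrec.fst.comp (Primrec.snd.comp he)) (Primrec.const _)).and
      ((Primrec.eq.comp (Primrec.fst.comp hq) (Primrec.const _)).and
      (Primrec.eq.comp (Primrec.snd.comp hq).matrix_list_prod Primrec.snd)))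
  exact h.exists_mem_list

theorem primrecPred_isSaturated : PrimrecPred IsSaturated := by
  have h1 : PrimrecPred fun L : List Edge => ∀ e ∈ L, IsLetter e.2.1 :=
    PrimrecPred.forall_mem_list
      (primrecPred_isLetter.comp (Primrec.fst.comp Primrec.snd))
  have h2 : PrimrecRel fun (e' : Edge) (z : Edge × List Edge) =>
      ¬ (z.1.2.2 = e'.1 ∧ Compatible z.1.2.1 e'.2.1) ∨
        (z.1.1, z.1.2.1 * e'.2.1, e'.2.2) ∈ z.2 := by
    have he : Primrec fun p : Edge × (Edge × List Edge) => p.2.1 := Primrec.fst.comp Primrec.snd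
    have he' : Primrec fun p : Edge × (Edge × List Edge) => p.1 := Primrec.fst
    have hL : Primrec fun p : Edge × (Edge × List Edge) => p.2.2 := Primrec.snd.comp Primrec.snd
    have hg := Primrec.fst.comp (Primrec.snd.comp he)
    have hg' := Primrec.fst.comp (Primrec.snd.comp he')
    exact ((Primrec.eq.comp (Primrec.snd.comp (Primrec.snd.comp he)) (Primrec.fst.comp he')).and
      (primrecRel_compatible.comp hg hg')).not.or
      (primrecRel_mem.comp ((Primrec.fst.comp he).pair
        ((hg.matrix_mul hg').pair (Primrec.snd.comp (Primrec.snd.comp he')))) hL)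
  have h3 : PrimrecRel fun (e : Edge) (L : List Edge) => ∀ e' ∈ L,
      ¬ (e.2.2 = e'.1 ∧ Compatible e.2.1 e'.2.1) ∨ (e.1, e.2.1 * e'.2.1, e'.2.2) ∈ L :=
    h2.forall_mem_list.comp Primrec.snd Primrec.id
  have h4 : PrimrecRel fun (e : Edge) (L : List Edge) =>
      e.2.2.2 = [] ∨ (e.2.2, e.2.2.2.headI, (e.2.2.1, e.2.2.2.tail)) ∈ L := by
    have hq : Primrec fun p : Edge × List Edge => p.1.2.2 :=
      Primrec.snd.comp (Primrec.snd.comp Primrec.fst)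
    have hw := Primrec.snd.comp hq
    exact (Primrec.eq.comp hw (Primrec.const [])).or
      (primrecRel_mem.comp (hq.pair ((Primrec.list_headI.comp hw).pair
        ((Primrec.fst.comp hq).pair (Primrec.list_tail.comp hw)))) Primrec.snd)
  exact h1.and ((h3.forall_mem_list.comp Primrec.id Primrec.id).and
    (h4.forall_mem_list.comp Primrec.id Primrec.id))

theorem PrimrecPred.separates {α : Type*} [Primcodable α] {Ms : α → List IntMat} {A B : α → IntMat}
    {L : α → List Edge} (hMs : Primrec Ms) (hA : Primrec A) (hB : Primrec B) (hL : Primrec L) :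
    PrimrecPred fun a => Separates (Ms a) (A a) (B a) (L a) :=
  (primrecPred_isSaturated.comp hL).and
    (((primrecRel_hasWord 0 0).swap.forall_mem_list.comp hMs hL).and
    (((primrecRel_hasWord 0 1).comp hL hA).and
    (((primrecRel_hasWord 1 1).comp hL (Primrec.const _)).and
    (((primrecRel_hasWord 1 1).comp hL (Primrec.const _)).and
    (((primrecRel_hasWord 1 2).comp hL hB).and
    (primrecRel_mem.comp (Primrec.const _) hL).not)))))

theorem primrecPred_forall_det : PrimrecPred fun Ms : List IntMat => ∀ M ∈ Ms, M.det = 1 :=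
  PrimrecPred.forall_mem_list
    (Primrec.eq.comp (Primrec.matrix_det Primrec.id) (Primrec.const 1))

/-- The instances of the vector reachability problem with an affirmative answer. -/
def ReachablePair (c : ((ℤ × ℤ) × (ℤ × ℤ)) × List IntMat) : Prop :=
  (∀ M ∈ c.2, M.det = 1) ∧
    ∃ M ∈ Submonoid.closure {M | M ∈ c.2}, IntMat.apply M c.1.1 = c.1.2

theorem computablePred_reachablePair : ComputablePred ReachablePair := by
  have hpos : PrimrecRel fun (c : ((ℤ × ℤ) × (ℤ × ℤ)) × List IntMat) (w : List IntMat) =>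
      (∀ M ∈ c.2, M.det = 1) ∧ (∀ N ∈ w, N ∈ c.2) ∧ IntMat.apply w.prod c.1.1 = c.1.2 := by
    have hc : Primrec fun p : (((ℤ × ℤ) × (ℤ × ℤ)) × List IntMat) × List IntMat => p.1 :=
      Primrec.fst
    have hv := Primrec.fst.comp hc
    have hMs := Primrec.snd.comp hc
    exact (primrecPred_forall_det.comp hMs).and
      ((primrecRel_mem.forall_mem_list.comp Primrec.snd hMs).and
      (Primrec.eq.comp (Primrec.snd.matrix_list_prod.matrix_apply (Primrec.fst.comp hv))
        (Primrec.snd.comp hv)))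
  have hneg : PrimrecRel fun (c : ((ℤ × ℤ) × (ℤ × ℤ)) × List IntMat) (z : Certificate) =>
      ¬ (∀ M ∈ c.2, M.det = 1) ∨ Refutes c.1 c.2 z := by
    have hc : Primrec fun p : (((ℤ × ℤ) × (ℤ × ℤ)) × List IntMat) × Certificate => p.1 :=
      Primrec.fst
    have hz : Primrec fun p : (((ℤ × ℤ) × (ℤ × ℤ)) × List IntMat) × Certificate => p.2 :=
      Primrec.snd
    have hx := Primrec.fst.comp (Primrec.fst.comp hc)
    have hy := Primrec.snd.comp (Primrec.fst.comp hc)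
    have hMs := Primrec.snd.comp hc
    have hA := Primrec.fst.comp (Primrec.fst.comp hz)
    have hB := Primrec.snd.comp (Primrec.fst.comp hz)
    have hd := Primrec.fst.comp (Primrec.fst.comp (Primrec.snd.comp hz))
    have hd' := Primrec.snd.comp (Primrec.fst.comp (Primrec.snd.comp hz))
    have hL := Primrec.snd.comp (Primrec.snd.comp hz)
    exact (primrecPred_forall_det.comp hMs).not.or
      (((Primrec.eq.comp hA.matrix_det (Primrec.const 1)).and
        (Primrec.eq.comp hB.matrix_det (Primrec.const 1))).and
      (((Primrec.eq.comp (hA.matrix_apply ((primrec_natCast_int.comp hd).pair (Primrec.const 0)))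
        hx).and (Primrec.eq.comp (hB.matrix_apply hy)
          ((primrec_natCast_int.comp hd').pair (Primrec.const 0)))).and
      ((Primrec.eq.comp hd hd').not.or ((Primrec.eq.comp hd (Primrec.const 0)).not.and
        (PrimrecPred.separates hMs hA hB hL)))))
  refine ComputablePred.of_certificates hpos hneg (fun c => ?_) (fun c => ?_)
  · simp only [ReachablePair, mem_closure_iff_exists_list]
    aesop
  · by_cases hMs : ∀ M ∈ c.2, M.det = 1
    · have hiff := not_reachable_iff (v := c.1) hMs
      exact ⟨fun h => (hiff.1 fun h' => h ⟨hMs, h'⟩).imp fun z => Or.inr,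
        fun ⟨z, hz⟩ h => hiff.2 ⟨z, hz.resolve_left (not_not.2 hMs)⟩ h.2⟩
    -- Inputs with a determinant other than one are rejected outright; the certificate is a dummy.
    · exact ⟨fun _ => ⟨((1, 1), (0, 0), []), Or.inl hMs⟩, fun _ h => hMs h.1⟩

end IntMat

/-! ### Instances and their codes -/

theorem matrixCode_eq (M : SL(2, ℤ)) : matrixCode M = entriesEquiv (M : IntMat) := rfl

theorem matrixCode_injective : Function.Injective matrixCode := fun _ _ h =>
  Subtype.ext (entriesEquiv.injective h)

theorem vectorCode_injective : Function.Injective vectorCode := by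
  intro x y h
  simp only [vectorCode, Prod.mk.injEq] at h
  ext i
  fin_cases i
  exacts [h.1, h.2]

theorem ratCode_injective : Function.Injective ratCode := by
  intro x y h
  simp only [ratCode, Prod.mk.injEq] at h
  exact Rat.ext h.1 h.2

theorem mem_closure_map_coe {Ms : List SL(2, ℤ)} {N : IntMat} :
    N ∈ Submonoid.closure {N | N ∈ Ms.map fun M : SL(2, ℤ) => (M : IntMat)} ↔
      ∃ M ∈ generatedSemigroup Ms, (M : IntMat) = N := by
  let φ : SL(2, ℤ) →* IntMat :=
    { toFun := fun M => M
      map_one' := Matrix.SpecialLinearGroup.coe_one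
      map_mul' := Matrix.SpecialLinearGroup.coe_mul }
  have h : {N | N ∈ Ms.map fun M : SL(2, ℤ) => (M : IntMat)} = φ '' {M | M ∈ Ms} := by
    ext N
    simp [φ]
  rw [h, ← MonoidHom.map_mclosure]
  rfl

theorem exists_map_matrixCode_eq {l : List ((ℤ × ℤ) × (ℤ × ℤ))}
    (hl : ∀ M ∈ l.map entriesEquiv.symm, M.det = 1) :
    ∃ Ms : List SL(2, ℤ), Ms.map matrixCode = l := by
  induction l with
  | nil => exact ⟨[], rfl⟩
  | cons c l ih =>
    obtain ⟨Ms, rfl⟩ := ih fun M hM => hl M (List.mem_cons_of_mem _ hM)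
    exact ⟨⟨entriesEquiv.symm c, hl _ (by simp)⟩ :: Ms, rfl⟩

theorem map_symm_map_matrixCode (Ms : List SL(2, ℤ)) :
    (Ms.map matrixCode).map entriesEquiv.symm = Ms.map fun M : SL(2, ℤ) => (M : IntMat) := by
  rw [List.map_map]
  exact List.map_congr_left fun M _ => entriesEquiv.symm_apply_apply _

theorem reachablePair_map {v : (ℤ × ℤ) × (ℤ × ℤ)} {Ms : List SL(2, ℤ)} :
    IntMat.ReachablePair (v, (Ms.map matrixCode).map entriesEquiv.symm) ↔
      ∃ M ∈ generatedSemigroup Ms, IntMat.apply (M : IntMat) v.1 = v.2 := by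
  rw [map_symm_map_matrixCode, IntMat.ReachablePair]
  constructor
  · rintro ⟨-, N, hN, h⟩
    obtain ⟨M, hM, rfl⟩ := mem_closure_map_coe.1 hN
    exact ⟨M, hM, h⟩
  · rintro ⟨M, hM, h⟩
    refine ⟨fun N hN => ?_, M, mem_closure_map_coe.2 ⟨M, hM, rfl⟩, h⟩
    obtain ⟨K, -, rfl⟩ := List.mem_map.1 hN
    exact K.2

theorem primrec_map_entriesEquiv_symm :
    Primrec fun l : List ((ℤ × ℤ) × (ℤ × ℤ)) => l.map entriesEquiv.symm :=
  Primrec.list_map Primrec.id (primrec_entriesEquiv_symm.comp Primrec.snd).to₂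

theorem vectorCode_mulVec (M : IntMat) (x : Fin 2 → ℤ) :
    vectorCode (M.mulVec x) = IntMat.apply M (vectorCode x) := by
  simp [vectorCode, IntMat.apply, Matrix.mulVec, dotProduct, Fin.sum_univ_two]

theorem VectorInstance.reachable_iff (i : VectorInstance) :
    i.Reachable ↔
      IntMat.ReachablePair (i.code.1, i.code.2.map entriesEquiv.symm) := by
  rw [VectorInstance.code, reachablePair_map, VectorInstance.Reachable]
  simp only [← vectorCode_mulVec, vectorCode_injective.eq_iff]

theorem VectorInstance.code_injective : Function.Injective VectorInstance.code := by
  rintro ⟨x, y, Ms⟩ ⟨x', y', Ms'⟩ h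
  simp only [VectorInstance.code, Prod.mk.injEq] at h
  obtain rfl := vectorCode_injective h.1.1
  obtain rfl := vectorCode_injective h.1.2
  obtain rfl := matrixCode_injective.list_map h.2
  rfl

theorem isDecidableProblem_vectorInstance :
    IsDecidableProblem VectorInstance.code VectorInstance.Reachable := by
  refine ⟨VectorInstance.code_injective, (IntMat.computablePred_reachablePair.comp_computable
    (Primrec.fst.pair (primrec_map_entriesEquiv_symm.comp Primrec.snd)).to_comp).of_eq
    fun c => ⟨fun hc => ?_, ?_⟩⟩
  · obtain ⟨⟨⟨a, b⟩, a', b'⟩, l⟩ := c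
    obtain ⟨Ms, rfl⟩ := exists_map_matrixCode_eq hc.1
    exact ⟨⟨![a, b], ![a', b'], Ms⟩, rfl, (VectorInstance.reachable_iff _).2 hc⟩
  · rintro ⟨i, rfl, hi⟩
    exact i.reachable_iff.1 hi

/-! ### The reachability problem by fractional linear transformations -/

theorem fracLinearMap_coe_eq_coe_iff (M : SL(2, ℤ)) (x y : ℚ) :
    fracLinearMap M (x : OnePoint ℚ) = (y : OnePoint ℚ) ↔
      IntMat.apply (M : IntMat) (x.num, (x.den : ℤ)) = (y.num, (y.den : ℤ)) ∨
        IntMat.apply (M : IntMat) (x.num, (x.den : ℤ)) = (-y.num, -(y.den : ℤ)) := by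
  have hdet : M 0 0 * M 1 1 - M 0 1 * M 1 0 = 1 := by
    rw [← Matrix.det_fin_two]
    exact M.2
  set X : ℤ := M 0 0 * x.num + M 0 1 * x.den with hX
  set Y : ℤ := M 1 0 * x.num + M 1 1 * x.den with hY
  have happ : IntMat.apply (M : IntMat) (x.num, (x.den : ℤ)) = (X, Y) := rfl
  have hxd : (x.den : ℚ) ≠ 0 := by exact_mod_cast x.den_ne_zero
  have hnum : (M 0 0 : ℚ) * x + M 0 1 = X / x.den := by
    rw [eq_div_iff hxd, hX]
    push_cast
    linear_combination (M 0 0 : ℚ) * Rat.mul_den_eq_num x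
  have hden : (M 1 0 : ℚ) * x + M 1 1 = Y / x.den := by
    rw [eq_div_iff hxd, hY]
    push_cast
    linear_combination (M 1 0 : ℚ) * Rat.mul_den_eq_num x
  -- Bézout coefficients of `x` are carried over by the inverse matrix, so no cancellation occurs in
  -- `X / Y`.
  have hcop : IsCoprime X Y := by
    obtain ⟨u, v, huv⟩ : IsCoprime x.num (x.den : ℤ) := by
      rw [Int.isCoprime_iff_nat_coprime]
      exact x.reduced
    refine ⟨u * M 1 1 - v * M 1 0, v * M 0 0 - u * M 0 1, ?_⟩
    rw [hX, hY]
    linear_combination (u * x.num + v * x.den) * hdet + huv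
  have hcop' : Nat.Coprime X.natAbs Y.natAbs := Int.isCoprime_iff_nat_coprime.1 hcop
  have hyd : 0 < (y.den : ℤ) := by exact_mod_cast y.den_pos
  have hycop : Nat.Coprime y.num.natAbs (y.den : ℤ).natAbs := y.reduced
  have hye : y = (y.num : ℚ) / ((y.den : ℤ) : ℚ) := by
    rw [Int.cast_natCast]
    exact (Rat.num_div_den y).symm
  have hval : fracLinearMap M (x : OnePoint ℚ) =
      if (Y : ℚ) = 0 then OnePoint.infty else (((X : ℚ) / Y : ℚ) : OnePoint ℚ) := by
    change (if (M 1 0 : ℚ) * x + (M 1 1 : ℚ) = 0 then OnePoint.infty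
      else ((((M 0 0 : ℚ) * x + (M 0 1 : ℚ)) / ((M 1 0 : ℚ) * x + (M 1 1 : ℚ)) : ℚ) :
        OnePoint ℚ)) = _
    rw [hnum, hden, div_div_div_cancel_right₀ hxd]
    simp only [div_eq_zero_iff, hxd, or_false]
  rw [hval, happ]
  by_cases hY0 : Y = 0
  · rw [if_pos (by exact_mod_cast hY0), hY0]
    simp only [Prod.mk.injEq, OnePoint.infty_ne_coe, false_iff]
    omega
  · rw [if_neg (by exact_mod_cast hY0), OnePoint.coe_eq_coe]
    constructor
    · intro h
      rw [hye] at h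
      -- The denominator of `y` is positive, so the sign of `Y` decides between the two vectors.
      rcases lt_or_gt_of_ne hY0 with hneg | hpos
      · right
        have h2 : ((-X : ℤ) : ℚ) / ((-Y : ℤ) : ℚ) = (y.num : ℚ) / ((y.den : ℤ) : ℚ) := by
          rw [Int.cast_neg, Int.cast_neg, neg_div_neg_eq, h]
        have := Rat.div_int_inj (by omega) hyd (by simpa using hcop') hycop h2
        ext <;> dsimp only <;> omega
      · left
        have := Rat.div_int_inj hpos hyd hcop' hycop h
        ext <;> dsimp only <;> omega
    · rintro (h | h)
      · rw [(Prod.mk.inj h).1, (Prod.mk.inj h).2]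
        exact hye.symm
      · rw [(Prod.mk.inj h).1, (Prod.mk.inj h).2, Int.cast_neg, Int.cast_neg, neg_div_neg_eq]
        exact hye.symm

/-- The vectors that represent a pair of fractions, up to the sign of the second one. -/
def fractionPair (s : ℤ) (v : (ℤ × ℕ) × (ℤ × ℕ)) : (ℤ × ℤ) × (ℤ × ℤ) :=
  ((v.1.1, v.1.2), (s * v.2.1, s * v.2.2))

theorem primrec_fractionPair (s : ℤ) : Primrec (fractionPair s) := by
  have h1 : Primrec fun v : (ℤ × ℕ) × (ℤ × ℕ) => v.1 := Primrec.fst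
  have h2 : Primrec fun v : (ℤ × ℕ) × (ℤ × ℕ) => v.2 := Primrec.snd
  exact ((Primrec.fst.comp h1).pair (primrec_natCast_int.comp (Primrec.snd.comp h1))).pair
    (((Primrec.const s).int_mul (Primrec.fst.comp h2)).pair
      ((Primrec.const s).int_mul (primrec_natCast_int.comp (Primrec.snd.comp h2))))

/-- A pair of an integer and a natural number is the code of a rational number. -/
def IsRatCode (c : ℤ × ℕ) : Prop := c.2 ≠ 0 ∧ c.1.natAbs.Coprime c.2

theorem isRatCode_iff {c : ℤ × ℕ} : IsRatCode c ↔ ∃ q, ratCode q = c := by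
  constructor
  · rintro ⟨h1, h2⟩
    exact ⟨⟨c.1, c.2, h1, h2⟩, rfl⟩
  · rintro ⟨q, rfl⟩
    exact ⟨q.den_ne_zero, q.reduced⟩

theorem primrecPred_isRatCode : PrimrecPred IsRatCode := by
  have h : Primrec fun c : ℤ × ℕ => c.1.natAbs :=
    (Primrec.nat_add.comp (primrec_int_toNat.comp Primrec.fst)
      (primrec_int_neg_toNat.comp Primrec.fst)).of_eq fun c => by omega
  exact (Primrec.eq.comp Primrec.snd (Primrec.const 0)).not.and
    (primrecPred_coprime.comp (h.pair Primrec.snd))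

theorem PointInstance.reachable_iff (i : PointInstance) :
    i.Reachable ↔
      IntMat.ReachablePair (fractionPair 1 i.code.1, i.code.2.map entriesEquiv.symm) ∨
        IntMat.ReachablePair (fractionPair (-1) i.code.1, i.code.2.map entriesEquiv.symm) := by
  rw [PointInstance.code, reachablePair_map, reachablePair_map, PointInstance.Reachable]
  simp only [fracLinearMap_coe_eq_coe_iff, fractionPair, ratCode, one_mul, neg_one_mul, and_or_left,
    exists_or]

theorem PointInstance.code_injective : Function.Injective PointInstance.code := by
  rintro ⟨x, y, Ms⟩ ⟨x', y', Ms'⟩ h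
  simp only [PointInstance.code, Prod.mk.injEq] at h
  obtain rfl := ratCode_injective h.1.1
  obtain rfl := ratCode_injective h.1.2
  obtain rfl := matrixCode_injective.list_map h.2
  rfl

theorem isDecidableProblem_pointInstance :
    IsDecidableProblem PointInstance.code PointInstance.Reachable := by
  have hs (s : ℤ) : ComputablePred fun c : ((ℤ × ℕ) × (ℤ × ℕ)) × List ((ℤ × ℤ) × (ℤ × ℤ)) =>
      IntMat.ReachablePair (fractionPair s c.1, c.2.map entriesEquiv.symm) :=
    IntMat.computablePred_reachablePair.comp_computable
      (((primrec_fractionPair s).comp Primrec.fst).pair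
        (primrec_map_entriesEquiv_symm.comp Primrec.snd)).to_comp
  -- Pairs that are not fractions in lowest terms code no instance and have to be filtered out.
  have hr : PrimrecPred fun c : ((ℤ × ℕ) × (ℤ × ℕ)) × List ((ℤ × ℤ) × (ℤ × ℤ)) =>
      IsRatCode c.1.1 ∧ IsRatCode c.1.2 :=
    (primrecPred_isRatCode.comp (Primrec.fst.comp Primrec.fst)).and
      (primrecPred_isRatCode.comp (Primrec.snd.comp Primrec.fst))
  refine ⟨PointInstance.code_injective, (hr.computablePred.and_pred
    ((hs 1).or_pred (hs (-1)))).of_eq fun c => ⟨fun hc => ?_, ?_⟩⟩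
  · obtain ⟨⟨a, b⟩, l⟩ := c
    obtain ⟨⟨ha, hb⟩, hc⟩ := hc
    obtain ⟨x, rfl⟩ := isRatCode_iff.1 ha
    obtain ⟨y, rfl⟩ := isRatCode_iff.1 hb
    obtain ⟨Ms, rfl⟩ := exists_map_matrixCode_eq (hc.elim And.left And.left)
    exact ⟨⟨x, y, Ms⟩, rfl, (PointInstance.reachable_iff _).2 hc⟩
  · rintro ⟨i, rfl, hi⟩
    exact ⟨⟨isRatCode_iff.2 ⟨_, rfl⟩, isRatCode_iff.2 ⟨_, rfl⟩⟩, i.reachable_iff.1 hi⟩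

theorem theorem3 :
    IsDecidableProblem VectorInstance.code VectorInstance.Reachable ∧
      IsDecidableProblem PointInstance.code PointInstance.Reachable := by
  exact ⟨isDecidableProblem_vectorInstance, isDecidableProblem_pointInstance⟩
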